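/- Let $\mathrm{cov}(\mathrm{meager})$ be the least cardinal $\kappa$ such that the Baire space $\omega^\omega$ is a union of $\kappa$ meager sets. For $1\le\alpha<\omega_1$ let $\mathbf\Sigma^0_\alpha$, $\mathbf\Pi^0_\alpha$ be the usual Borel classes ($\mathbf\Sigma^0_1$ = open sets, $\mathbf\Pi^0_\alpha$ = complements of $\mathbf\Sigma^0_\alpha$ sets, and, for $\alpha>1$, $\mathbf\Sigma^0_\alpha$ = countable unions of sets from $\bigcup_{1\le\beta<\alpha}\mathbf\Pi^0_\beta$); a family of sets has bounded Borel rank if there is $\alpha<\omega_1$ such that each member of the family lies in $\mathbf\Sigma^0_\beta\cup\mathbf\Pi^0_\beta$ for some $1\le\beta\le\alpha$. A set $E$ separates $C$ from $D$ if $C\subseteq E$ and $E\cap D=\emptyset$. In every uncountable Polish space $X$ there exist two disjoint coanalytic sets $C$, $D$ such that, for every family $\mathcal F$ of fewer than $\mathrm{cov}(\mathrm{meager})$ subsets of $X$ of bounded Borel rank, the union $\bigcup\mathcal F$ neither separates $C$ from $D$ nor separates $D$ from $C$. -/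

import Mathlib

universe u

namespace BorelSep

/-- The additive Borel classes `Σ⁰_α` of a topological space. `Σ⁰_1` consists of the open sets, and
for `α > 1` the class `Σ⁰_α` consists of the countable unions of sets, each of which is the
complement of a set in `Σ⁰_β` for some `β < α`. (`Σ⁰_0` has no members, so effectively `1 ≤ β`.) -/
inductive IsSigma0 {X : Type u} [TopologicalSpace X] : Ordinal.{0} → Set X → Prop
  | of_isOpen {s : Set X} (hs : IsOpen s) : IsSigma0 1 s
  | iUnion_compl {α : Ordinal.{0}} (hα : 1 < α) (β : ℕ → Ordinal.{0}) (hβ : ∀ n, β n < α)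
      (s : ℕ → Set X) (hs : ∀ n, IsSigma0 (β n) (s n)) : IsSigma0 α (⋃ n, (s n)ᶜ)

/-- The multiplicative Borel classes `Π⁰_α`: complements of `Σ⁰_α` sets. -/
def IsPi0 {X : Type u} [TopologicalSpace X] (α : Ordinal.{0}) (s : Set X) : Prop :=
  IsSigma0 α sᶜ

/-- A family of Borel sets of bounded rank: for some countable ordinal `α`, every member of the
family is in `Σ⁰_β` or `Π⁰_β` for some `β ≤ α`. -/
def HasBoundedBorelRank {X : Type u} [TopologicalSpace X] (F : Set (Set X)) : Prop :=
  ∃ α : Ordinal.{0}, α < Ordinal.omega 1 ∧ ∀ s ∈ F, ∃ β ≤ α, IsSigma0 β s ∨ IsPi0 β s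

/-- A set is coanalytic if its complement is analytic. -/
def IsCoanalytic {X : Type u} [TopologicalSpace X] (s : Set X) : Prop :=
  MeasureTheory.AnalyticSet sᶜ

/-- `cov(meager)`: the least cardinality of a family of meager sets whose union is the whole Baire
space `ℕ → ℕ`. -/
noncomputable def covMeager : Cardinal.{0} :=
  sInf {κ : Cardinal.{0} | ∃ F : Set (Set (ℕ → ℕ)),
    Cardinal.mk F = κ ∧ (∀ s ∈ F, IsMeagre s) ∧ ⋃₀ F = Set.univ}

/-- `E` separates `C` from `D`. -/
def Separates {X : Type u} (E C D : Set X) : Prop :=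
  C ⊆ E ∧ Disjoint E D

end BorelSep

open Set Filter MeasureTheory PiNat
open scoped Cardinal

namespace BorelSep

universe v

/-! ### Borel classes and meager sets -/

/-! Read `x : ℕ → ℕ` as a forest and compare the ranks of nodes 0 and 1 by simulations. Having a
simulation is analytic, and any two nodes are comparable, so "1 strictly above 0" and "0 strictly
above 1" are disjoint and coanalytic.

For a family of rank at most `α`, use category with tagged forests (Steel forcing). A code `z`
yields a forest with ordinal tags decreasing from parent to child, then the tags are forgotten. For
generic `z` tags are faithful to rank, so root tags `(δ, δ + 1)` land in one set and `(δ + 1, δ)` in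
the other. With `δ = ω * (α + 2)`, Borel sets of rank about `α` cannot tell these choices apart:
tags at least `ω * β` can be changed without affecting `Σ⁰_β` statements about generic forests
(`TagEquiv.extend`, `RetaggingSystem.isMeagre_inter_preimage`).

If fewer than `covMeager` sets cover the first set, one has nonmeager preimage under the first
coding, hence under the second by retagging, so it meets the other set. A continuous injection of
the Baire space carries this to `X`. -/

theorem IsSigma0.one_le {X : Type u} [TopologicalSpace X] {α : Ordinal.{0}} {s : Set X}
    (hs : IsSigma0 α s) : 1 ≤ α := by
  cases hs with
  | of_isOpen => exact le_rfl
  | iUnion_compl hα => exact hα.le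

theorem IsSigma0.preimage {X Y : Type*} [TopologicalSpace X] [TopologicalSpace Y] {f : X → Y}
    (hf : Continuous f) {α : Ordinal.{0}} {s : Set Y} (hs : IsSigma0 α s) :
    IsSigma0 α (f ⁻¹' s) := by
  induction hs with
  | of_isOpen h => exact .of_isOpen (h.preimage hf)
  | iUnion_compl hα β hβ s _ ih =>
    rw [preimage_iUnion]
    exact .iUnion_compl hα β hβ _ ih

theorem IsSigma0.measurableSet {X : Type*} [TopologicalSpace X] [MeasurableSpace X]
    [BorelSpace X] {α : Ordinal.{0}} {s : Set X} (hs : IsSigma0 α s) : MeasurableSet s := by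
  induction hs with
  | of_isOpen h => exact h.measurableSet
  | iUnion_compl _ _ _ s _ ih => exact .iUnion fun n => (ih n).compl

theorem IsSigma0.compl_add_one {X : Type u} [TopologicalSpace X] {α : Ordinal.{0}} {s : Set X}
    (hs : IsSigma0 α s) : IsSigma0 (α + 1) sᶜ := by
  have h := IsSigma0.iUnion_compl (α := α + 1) (hs.one_le.trans_lt (lt_add_one α))
    (fun _ => α) (fun _ => lt_add_one α) (fun _ => s) (fun _ => hs)
  rwa [iUnion_const] at h

theorem lift_covMeager_le {ι : Type u} (M : ι → Set (ℕ → ℕ)) (hM : ∀ i, IsMeagre (M i))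
    (h : ⋃ i, M i = univ) : Cardinal.lift.{u, 0} covMeager ≤ #ι := by
  have h1 : covMeager ≤ #(range M) := by
    refine csInf_le' ⟨range M, rfl, ?_, ?_⟩
    · rintro _ ⟨i, rfl⟩
      exact hM i
    · rw [sUnion_range, h]
  calc Cardinal.lift.{u, 0} covMeager ≤ Cardinal.lift.{u, 0} #(range M) := Cardinal.lift_le.2 h1
    _ ≤ Cardinal.lift.{0, u} #ι := Cardinal.mk_range_le_lift
    _ = #ι := Cardinal.lift_id'.{0, u} _

theorem not_isMeagre_cylinder (z : ℕ → ℕ) (n : ℕ) : ¬ IsMeagre (cylinder z n) :=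
  not_isMeagre_of_isOpen (isOpen_cylinder _ z n) ⟨z, self_mem_cylinder z n⟩

theorem exists_cylinder_subset {U : Set (ℕ → ℕ)} (hU : IsOpen U) {z : ℕ → ℕ} (hz : z ∈ U)
    (n : ℕ) : ∃ k, n ≤ k ∧ cylinder z k ⊆ U := by
  obtain ⟨V, ⟨y, m, rfl⟩, hzV, hVU⟩ :=
    (isTopologicalBasis_cylinders (fun _ : ℕ => ℕ)).exists_subset_of_mem_open hz hU
  refine ⟨max n m, le_max_left _ _, (cylinder_anti z (le_max_right _ _)).trans ?_⟩
  rwa [mem_cylinder_iff_eq.1 hzV]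

/-- A nonmeager Borel set is comeager in some cylinder. -/
theorem exists_isMeagre_cylinder_diff {B : Set (ℕ → ℕ)} (hB : MeasurableSet B) {w : ℕ → ℕ} {n : ℕ}
    (h : ¬ IsMeagre (cylinder w n ∩ B)) :
    ∃ w' ∈ cylinder w n, ∃ k, n ≤ k ∧ IsMeagre (cylinder w' k \ B) := by
  obtain ⟨U, hU, hBU⟩ := hB.residualEq_isOpen
  have hd : {x | ¬ (x ∈ B ↔ x ∈ U)} = {x | x ∈ B ↔ x ∈ U}ᶜ := rfl
  have hm : IsMeagre {x | ¬ (x ∈ B ↔ x ∈ U)} := by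
    rw [hd, IsMeagre, compl_compl]
    exact hBU.mem_iff
  have hne : (cylinder w n ∩ U).Nonempty := by
    by_contra hne
    refine h (hm.mono ?_)
    rintro x ⟨hx, hxB⟩ hiff
    exact hne ⟨x, hx, hiff.1 hxB⟩
  obtain ⟨w', hw', hwU⟩ := hne
  obtain ⟨k, hk, hkU⟩ := exists_cylinder_subset hU hwU n
  refine ⟨w', hw', k, hk, hm.mono ?_⟩
  rintro x ⟨hx, hxB⟩ hiff
  exact hxB (hiff.2 (hkU hx))

/-! ### Indiscernibility of conditions for Borel classes -/

/-- A system of relations between conditions `(i, z, n)`, where `z` stands for its first `n` values,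
indexed by ordinals, that has the back-and-forth extension property with respect to a family of
maps of the Baire space to itself. -/
structure RetaggingSystem {ι : Type v} (Φ : ι → (ℕ → ℕ) → (ℕ → ℕ))
    (E : Ordinal.{0} → ℕ → ι → (ℕ → ℕ) → ι → (ℕ → ℕ) → Prop) : Prop where
  continuous : ∀ i, Continuous (Φ i)
  symm : ∀ {β n i z j w}, E β n i z j w → E β n j w i z
  congr : ∀ {i n z z'}, z' ∈ cylinder z n → Φ i z' ∈ cylinder (Φ i z) n
  mem_cylinder : ∀ {β n i z j w}, E β n i z j w → Φ i z ∈ cylinder (Φ j w) n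
  extend : ∀ {β n i z j w}, E β n i z j w → ∀ β' < β, ∀ z' ∈ cylinder z n, ∀ k, n ≤ k →
    ∃ w' ∈ cylinder w n, E β' k i z' j w'

/-- Induction on Borel rank, as for a forcing relation: a nonmeager piece is comeager in a smaller
cylinder, and extending the equivalence to that cylinder costs one drop in level, as does passing to
a complement. -/
theorem RetaggingSystem.isMeagre_inter_preimage {ι : Type v} {Φ : ι → (ℕ → ℕ) → (ℕ → ℕ)}
    {E : Ordinal.{0} → ℕ → ι → (ℕ → ℕ) → ι → (ℕ → ℕ) → Prop} (hE : RetaggingSystem Φ E)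
    {β : Ordinal.{0}} {S : Set (ℕ → ℕ)} (hS : IsSigma0 β S) {n : ℕ} {i j : ι} {z w : ℕ → ℕ}
    (h : E β n i z j w) (hz : IsMeagre (cylinder z n ∩ Φ i ⁻¹' S)) :
    IsMeagre (cylinder w n ∩ Φ j ⁻¹' S) := by
  induction hS generalizing n i j z w with
  | of_isOpen hS =>
    by_contra hw
    obtain ⟨w', hw', hwS⟩ := nonempty_of_not_isMeagre hw
    obtain ⟨k, hk, hkS⟩ := exists_cylinder_subset hS hwS n
    obtain ⟨z', hz', hzw⟩ := hE.extend (hE.symm h) 0 zero_lt_one w' hw' k hk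
    refine not_isMeagre_cylinder z' k (hz.mono ?_)
    refine fun x hx => ⟨?_, ?_⟩
    · rw [← mem_cylinder_iff_eq.1 hz']
      exact cylinder_anti z' hk hx
    · apply hkS
      rw [mem_cylinder_iff_eq.1 (hE.mem_cylinder hzw)]
      exact hE.congr hx
  | iUnion_compl hα γ hγ s hs ih =>
    by_contra hw
    have : ∃ m, ¬ IsMeagre (cylinder w n ∩ Φ j ⁻¹' (s m)ᶜ) := by
      by_contra! hall
      apply hw
      rw [preimage_iUnion, inter_iUnion]
      exact isMeagre_iUnion hall
    obtain ⟨m, hm⟩ := this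
    obtain ⟨w', hw', k, hk, hwk⟩ := exists_isMeagre_cylinder_diff
      ((hE.continuous j).measurable (hs m).measurableSet.compl) hm
    obtain ⟨z', hz', hzw⟩ := hE.extend (hE.symm h) (γ m) (hγ m) w' hw' k hk
    have h1 : IsMeagre (cylinder z' k ∩ Φ i ⁻¹' s m) := by
      refine ih m hzw (hwk.mono ?_)
      rintro x ⟨hx, hxs⟩
      exact ⟨hx, fun h' => h' hxs⟩
    refine not_isMeagre_cylinder z' k (IsMeagre.mono (fun x hx => ?_) (h1.union hz))
    by_cases hxs : Φ i x ∈ s m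
    · exact Or.inl ⟨hx, hxs⟩
    · refine Or.inr ⟨?_, mem_iUnion.2 ⟨m, hxs⟩⟩
      rw [← mem_cylinder_iff_eq.1 hz']
      exact cylinder_anti z' hk hx

/-- If the `i`-images of almost all points are covered by fewer than `covMeager` sets of bounded rank,
then some of these sets contains the `j`-images of nonmeagerly many points. -/
theorem RetaggingSystem.exists_not_isMeagre {ι : Type v} {Φ : ι → (ℕ → ℕ) → (ℕ → ℕ)}
    {E : Ordinal.{0} → ℕ → ι → (ℕ → ℕ) → ι → (ℕ → ℕ) → Prop} (hE : RetaggingSystem Φ E)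
    {α : Ordinal.{0}} {κ : Type u} (A : κ → Set (ℕ → ℕ))
    (hA : ∀ a, ∃ β ≤ α, IsSigma0 β (A a) ∨ IsPi0 β (A a))
    (hκ : #κ < Cardinal.lift.{u, 0} covMeager) {i j : ι} {z w : ℕ → ℕ}
    (h : E (α + 1 + 1) 0 i z j w) {N : Set (ℕ → ℕ)} (hN : IsMeagre N)
    (hcov : ∀ x ∉ N, Φ i x ∈ ⋃ a, A a) :
    ∃ a, ¬ IsMeagre (Φ j ⁻¹' A a) := by
  have hex : ∃ a, ¬ IsMeagre (Φ i ⁻¹' A a) := by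
    by_contra! hall
    refine (lift_covMeager_le (fun a => Φ i ⁻¹' A a ∪ N) (fun a => (hall a).union hN) ?_).not_gt hκ
    refine eq_univ_of_forall fun x => mem_iUnion.2 ?_
    by_cases hx : x ∈ N
    -- `N` is absorbed into the indexed sets, which needs the index type to be nonempty.
    · obtain ⟨y, hy⟩ : Nᶜ.Nonempty := by
        by_contra hne
        rw [not_nonempty_iff_eq_empty, compl_empty_iff] at hne
        exact not_isMeagre_of_isOpen isOpen_univ univ_nonempty (hne ▸ hN)
      obtain ⟨a, _⟩ := mem_iUnion.1 (hcov y hy)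
      exact ⟨a, Or.inr hx⟩
    · obtain ⟨a, ha⟩ := mem_iUnion.1 (hcov x hx)
      exact ⟨a, Or.inl ha⟩
  obtain ⟨a, ha⟩ := hex
  refine ⟨a, fun hj => ?_⟩
  -- Complementing may raise the level by one; the extension below uses up the other `+ 1`.
  obtain ⟨β, hβ, hAβ⟩ : ∃ β ≤ α + 1, IsSigma0 β (A a)ᶜ := by
    obtain ⟨β, hβ, hs | hp⟩ := hA a
    · exact ⟨β + 1, add_le_add_left hβ 1, hs.compl_add_one⟩
    · exact ⟨β, hβ.trans (le_add_of_nonneg_right zero_le_one), hp⟩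
  have hmeas : MeasurableSet (Φ i ⁻¹' A a) :=
    (hE.continuous i).measurable (by simpa using hAβ.measurableSet.compl)
  obtain ⟨z', hz', k, hk, hzk⟩ := exists_isMeagre_cylinder_diff (w := z) (n := 0) hmeas
    (by rwa [cylinder_zero, univ_inter])
  obtain ⟨w', hw', hzw⟩ := hE.extend h β (Order.lt_add_one_iff.2 hβ) z' hz' k hk
  have h1 := hE.isMeagre_inter_preimage hAβ hzw hzk
  refine not_isMeagre_cylinder w' k (IsMeagre.mono (fun x hx => ?_) (h1.union hj))
  by_cases hxs : Φ j x ∈ A a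
  · exact Or.inr hxs
  · exact Or.inl ⟨hx, hxs⟩

/-! ### Comparison of ranks of nodes -/

/-- A simulation on the forest in which `m` is a child of `n` when `x m = n` and `n < m`. -/
def IsSimulation (x : ℕ → ℕ) (S : ℕ → ℕ → Bool) : Prop :=
  ∀ m n, S m n → ∀ m', x m' = m → m < m' → ∃ n', x n' = n ∧ n < n' ∧ S m' n'

/-- The rank of the node `m` is at most the rank of the node `n`. -/
def RankLE (x : ℕ → ℕ) (m n : ℕ) : Prop :=
  ∃ S : ℕ → ℕ → Bool, IsSimulation x S ∧ S m n

theorem RankLE.exists_child {x : ℕ → ℕ} {m n m' : ℕ} (h : RankLE x m n) (hm : x m' = m)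
    (hlt : m < m') : ∃ n', x n' = n ∧ n < n' ∧ RankLE x m' n' := by
  obtain ⟨S, hS, hmn⟩ := h
  obtain ⟨n', h1, h2, h3⟩ := hS m n hmn m' hm hlt
  exact ⟨n', h1, h2, S, hS, h3⟩

/-- `RankLE` is the largest simulation, and it remains one when the pair `(m, n)` is added. -/
theorem RankLE.of_forall_child {x : ℕ → ℕ} {m n : ℕ}
    (h : ∀ m', x m' = m → m < m' → ∃ n', x n' = n ∧ n < n' ∧ RankLE x m' n') : RankLE x m n := by
  classical
  refine ⟨fun a b => decide (RankLE x a b ∨ (a = m ∧ b = n)), ?_, by simp⟩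
  intro a b hab a' ha hlt
  have : ∃ b', x b' = b ∧ b < b' ∧ RankLE x a' b' := by
    rcases of_decide_eq_true hab with hab | ⟨rfl, rfl⟩
    · exact hab.exists_child ha hlt
    · exact h a' ha hlt
  obtain ⟨b', h1, h2, h3⟩ := this
  exact ⟨b', h1, h2, decide_eq_true (Or.inl h3)⟩

/-- The converse of the negation of `RankLE` is itself a simulation. -/
theorem rankLE_total (x : ℕ → ℕ) (m n : ℕ) : RankLE x m n ∨ RankLE x n m := by
  classical
  by_contra! hcon
  refine hcon.2 ⟨fun b a => decide (¬ RankLE x a b), ?_, decide_eq_true hcon.1⟩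
  intro b a hab b' hb hlt
  have hab := of_decide_eq_true hab
  by_contra! hall
  refine hab (RankLE.of_forall_child fun a' ha' hlt' => ⟨b', hb, hlt, ?_⟩)
  have := hall a' ha' hlt'
  simpa using this

theorem analyticSet_rankLE (m n : ℕ) : AnalyticSet {x | RankLE x m n} := by
  have hmeas : MeasurableSet
      {p : (ℕ → ℕ) × (ℕ → ℕ → Bool) | IsSimulation p.1 p.2 ∧ p.2 m n = true} := by
    have hS : ∀ a b, Measurable fun p : (ℕ → ℕ) × (ℕ → ℕ → Bool) => p.2 a b := fun a b =>
      (measurable_pi_apply b).comp ((measurable_pi_apply a).comp measurable_snd)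
    refine measurableSet_setOfPred.2 ?_
    unfold IsSimulation
    fun_prop
  have hpolish : PolishSpace (ℕ → ℕ → Bool) := {}
  have := hmeas.analyticSet.image_of_continuous (continuous_fst (X := ℕ → ℕ) (Y := ℕ → ℕ → Bool))
  convert this using 1
  ext x
  simp [RankLE]

/-! ### Tagged forests -/

/-- The tags of the nodes: those of the nodes `0` and `1` are the parameters, and those of the
others are read off from `z` by means of the enumeration `e`. -/
def tag (e : ℕ → Ordinal.{0}) (r : Ordinal.{0} × Ordinal.{0}) (z : ℕ → ℕ) (m : ℕ) : Ordinal.{0} :=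
  if m = 0 then r.1 else if m = 1 then r.2 else e (z m).unpair.1

open Classical in
/-- The forest coded by `z`: a node gets the proposed parent if that one is an earlier node with a
larger tag, and none otherwise. -/
noncomputable def parent (e : ℕ → Ordinal.{0}) (r : Ordinal.{0} × Ordinal.{0}) (z : ℕ → ℕ)
    (m : ℕ) : ℕ :=
  if 2 ≤ m ∧ (z m).unpair.2 < m ∧ tag e r z m < tag e r z (z m).unpair.2 then (z m).unpair.2 else m

variable {e : ℕ → Ordinal.{0}} {r s : Ordinal.{0} × Ordinal.{0}} {z w : ℕ → ℕ} {m n : ℕ}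

theorem tag_of_two_le (hm : 2 ≤ m) : tag e r z m = e (z m).unpair.1 := by
  rw [tag, if_neg (by lia), if_neg (by lia)]

theorem tag_congr (h : z m = w m) : tag e r z m = tag e r w m := by
  simp only [tag, h]

theorem tag_congr_of_lt_two (hm : m < 2) : tag e r z m = tag e r w m := by
  interval_cases m <;> simp [tag]

theorem parent_congr (h : ∀ i ≤ m, z i = w i) : parent e r z m = parent e r w m := by
  have h0 := h m le_rfl
  by_cases hp : (w m).unpair.2 < m
  · simp only [parent, h0, tag_congr h0, tag_congr (h _ hp.le)]
  · simp only [parent, h0, hp, false_and, and_false, if_false]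

theorem parent_le : parent e r z m ≤ m := by
  rw [parent]
  split_ifs with h
  exacts [h.2.1.le, le_rfl]

theorem parent_of_lt_two (hm : m < 2) : parent e r z m = m := by
  rw [parent, if_neg (by lia)]

theorem tag_lt_of_parent_lt (h : parent e r z m < m) :
    tag e r z m < tag e r z (parent e r z m) := by
  rw [parent] at h ⊢
  split_ifs at h ⊢ with hc
  · exact hc.2.2
  · exact absurd h (lt_irrefl m)

theorem continuous_parent : Continuous (parent e r) := by
  refine continuous_pi fun m => continuous_iff_continuousAt.2 fun z => ?_
  refine (continuousAt_const (y := parent e r z m)).congr ?_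
  filter_upwards [(isOpen_cylinder _ z (m + 1)).mem_nhds (self_mem_cylinder z (m + 1))] with w hw
  exact parent_congr fun i hi => (hw i (Nat.lt_succ_of_le hi)).symm

theorem parent_mem_cylinder (h : w ∈ cylinder z n) :
    parent e r w ∈ cylinder (parent e r z) n :=
  fun _ hm => parent_congr fun i hi => h i (hi.trans_lt hm)

/-- Two tagged forests agree below `n` up to tags that are at least `ω * β`. -/
def TagEquiv (e : ℕ → Ordinal.{0}) (β : Ordinal.{0}) (n : ℕ) (r : Ordinal.{0} × Ordinal.{0})
    (z : ℕ → ℕ) (s : Ordinal.{0} × Ordinal.{0}) (w : ℕ → ℕ) : Prop :=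
  ∀ m, m < n ∨ m < 2 → parent e r z m = parent e s w m ∧
    (tag e r z m = tag e s w m ∨
      Ordinal.omega0 * β ≤ tag e r z m ∧ Ordinal.omega0 * β ≤ tag e s w m)

theorem exists_bound_of_lt {θ ζ : Ordinal.{0}} (hζ : ζ < θ)
    (f : ℕ → Ordinal.{0}) (k : ℕ) : ∃ η < θ, ζ ≤ η ∧ ∀ m < k, f m < θ → f m ≤ η := by
  induction k with
  | zero => exact ⟨ζ, hζ, le_rfl, by simp⟩
  | succ k ih =>
    obtain ⟨η, h1, h2, h3⟩ := ih
    by_cases hk : f k < θ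
    · refine ⟨max η (f k), max_lt h1 hk, h2.trans (le_max_left _ _), fun m hm hf => ?_⟩
      rcases Nat.lt_succ_iff_lt_or_eq.1 hm with hm | rfl
      · exact (h3 m hm hf).trans (le_max_left _ _)
      · exact le_max_right _ _
    · refine ⟨η, h1, h2, fun m hm hf => ?_⟩
      rcases Nat.lt_succ_iff_lt_or_eq.1 hm with hm | rfl
      · exact h3 m hm hf
      · exact absurd hf hk

theorem add_natCast_lt_of_isSuccLimit {θ η : Ordinal.{0}} (hθ : Order.IsSuccLimit θ) (hη : η < θ)
    (k : ℕ) : η + k < θ := by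
  induction k with
  | zero => simpa using hη
  | succ k ih =>
    rw [Nat.cast_succ, ← add_assoc]
    exact hθ.succ_lt ih

/-- New nodes keep their parents and their tags below `ω * β`. Larger tags are squeezed into the gap
between `ω * β'` and `ω * β`, where the limit `ω * β` leaves room for a finite descending sequence.
-/
theorem TagEquiv.extend {θ : Ordinal.{0}} (he : range e = Iio θ) {β β' : Ordinal.{0}}
    (h : TagEquiv e β n r z s w) (hβ : β' < β) {z' : ℕ → ℕ} (hz' : z' ∈ cylinder z n) (k : ℕ) :
    ∃ w' ∈ cylinder w n, TagEquiv e β' k r z' s w' := by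
  classical
  set L := Ordinal.omega0 * β with hL
  have hlim : Order.IsSuccLimit L :=
    Ordinal.isSuccLimit_mul_left Ordinal.isSuccLimit_omega0 (zero_le.trans_lt hβ)
  have hL' : Ordinal.omega0 * β' < L := mul_lt_mul_of_pos_left hβ Ordinal.omega0_pos
  obtain ⟨η, hηL, hη', hη⟩ := exists_bound_of_lt hL' (tag e r z') k
  -- The term `k - m` makes later nodes, hence children, get smaller tags; `η` keeps these tags
  -- above all unchanged small ones.
  let g : ℕ → Ordinal.{0} := fun m => if tag e r z' m < L then tag e r z' m else η + (k - m : ℕ)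
  have hgL : ∀ m, g m < L := by
    intro m
    simp only [g]
    split_ifs with hm
    exacts [hm, add_natCast_lt_of_isSuccLimit hlim hηL _]
  have hgθ : ∀ m, 2 ≤ m → ∃ c, e c = g m := by
    intro m hm
    have h1 : tag e r z' m < θ := by
      rw [tag_of_two_le hm]
      exact he.subset ⟨_, rfl⟩
    refine he.superset (show g m < θ from ?_)
    by_cases hmL : tag e r z' m < L
    · simpa only [g, if_pos hmL] using h1
    · exact (hgL m).trans ((not_lt.1 hmL).trans_lt h1)
  choose c hc using hgθ
  let w' : ℕ → ℕ := fun m => if hm : n ≤ m ∧ 2 ≤ m then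
    Nat.pair (c m hm.2) (parent e r z' m) else w m
  have hww : ∀ m < n, w' m = w m := fun m hm => dif_neg (by lia)
  have hold_tag_z : ∀ m, m < n ∨ m < 2 → tag e r z' m = tag e r z m := by
    rintro m (hm | hm)
    exacts [tag_congr (hz' m hm), tag_congr_of_lt_two hm]
  have hold_tag_w : ∀ m, m < n ∨ m < 2 → tag e s w' m = tag e s w m := by
    rintro m (hm | hm)
    exacts [tag_congr (hww m hm), tag_congr_of_lt_two hm]
  have hold : ∀ m, m < n ∨ m < 2 → tag e r z' m = tag e s w' m ∨
      L ≤ tag e r z' m ∧ L ≤ tag e s w' m := by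
    intro m hm
    rw [hold_tag_z m hm, hold_tag_w m hm]
    exact (h m hm).2
  have hnew : ∀ m, n ≤ m → 2 ≤ m → tag e s w' m = g m := by
    intro m h1 h2
    rw [tag_of_two_le h2]
    simp only [w', dif_pos (And.intro h1 h2), Nat.unpair_pair, hc]
  refine ⟨w', hww, fun m hm => ?_⟩
  by_cases hmold : m < n ∨ m < 2
  · refine ⟨?_, (hold m hmold).imp_right fun h' => ⟨hL'.le.trans h'.1, hL'.le.trans h'.2⟩⟩
    rcases hmold with hmn | hm2
    · rw [parent_mem_cylinder hz' m hmn, parent_mem_cylinder (z := w) hww m hmn]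
      exact (h m (Or.inl hmn)).1
    · rw [parent_of_lt_two hm2, parent_of_lt_two hm2]
  · have hnm : n ≤ m := by lia
    have h2m : 2 ≤ m := by lia
    have hmk : m < k := by lia
    constructor
    · have hpar : (w' m).unpair.2 = parent e r z' m := by
        simp only [w', dif_pos (And.intro hnm h2m), Nat.unpair_pair]
      by_cases hp : parent e r z' m < m
      · have hlt := tag_lt_of_parent_lt hp
        set p := parent e r z' m with hpdef
        have hlt' : tag e s w' m < tag e s w' p := by
          rw [hnew m hnm h2m]
          by_cases hpold : p < n ∨ p < 2
          · rcases hold p hpold with heq | ⟨_, h2⟩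
            · rw [← heq]
              by_cases hmL : tag e r z' m < L
              · simpa only [g, if_pos hmL] using hlt
              · exact (hgL m).trans_le ((not_lt.1 hmL).trans hlt.le)
            · exact (hgL m).trans_le h2
          · rw [hnew p (by lia) (by lia)]
            by_cases hpL : tag e r z' p < L
            · simpa only [g, if_pos hpL, if_pos (hlt.trans hpL)] using hlt
            · have hkp : (0 : Ordinal.{0}) < ((k - p : ℕ) : Ordinal.{0}) := by
                exact_mod_cast (by lia : 0 < k - p)
              by_cases hmL : tag e r z' m < L
              · simp only [g, if_pos hmL, if_neg hpL]
                exact (hη m hmk hmL).trans_lt (lt_add_of_pos_right η hkp)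
              · simp only [g, if_neg hmL, if_neg hpL]
                have : ((k - m : ℕ) : Ordinal.{0}) < ((k - p : ℕ) : Ordinal.{0}) := by
                  exact_mod_cast (by lia : k - m < k - p)
                exact (add_lt_add_iff_left η).2 this
        rw [parent, hpar, if_pos ⟨h2m, hp, hlt'⟩]
      · have : parent e r z' m = m := le_antisymm parent_le (not_lt.1 hp)
        -- A root proposes itself as parent, fails the test `m < m`, and so stays a root.
        rw [parent.eq_def e s, hpar, this, if_neg (by lia)]
    · rw [hnew m hnm h2m]
      by_cases hmL : tag e r z' m < L
      · exact Or.inl (by simp only [g, if_pos hmL])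
      · refine Or.inr ⟨hL'.le.trans (not_lt.1 hmL), ?_⟩
        simp only [g, if_neg hmL]
        exact hη'.trans (le_add_of_nonneg_right zero_le)

theorem retaggingSystem_tagEquiv {θ : Ordinal.{0}} (he : range e = Iio θ) :
    RetaggingSystem (parent e) (fun β n => TagEquiv e β n) where
  continuous _ := continuous_parent
  symm h m hm := ⟨(h m hm).1.symm, (h m hm).2.imp Eq.symm And.symm⟩
  congr h := parent_mem_cylinder h
  mem_cylinder h m hm := (h m (Or.inl hm)).1
  extend h _ hβ _ hz' k _ := h.extend he hβ hz' k

/-- In the forest coded by `z` each node has children of all tags that are allowed. -/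
def IsFull (e : ℕ → Ordinal.{0}) (r : Ordinal.{0} × Ordinal.{0}) (z : ℕ → ℕ) : Prop :=
  ∀ m c, e c < tag e r z m → ∃ m', m < m' ∧ parent e r z m' = m ∧ tag e r z m' = e c

theorem isMeagre_not_isFull : IsMeagre {z | ¬ IsFull e r z} := by
  -- Starting above `m + 1` ensures `m' ≥ 2`, so that the tag is read off `z`.
  let G : ℕ → ℕ → Set (ℕ → ℕ) := fun m c => ⋃ m' ∈ Ioi (m + 1), {z | z m' = Nat.pair c m}
  have hopen : ∀ m c, IsOpen (G m c) := fun m c => isOpen_biUnion fun m' _ =>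
    (isOpen_discrete ({Nat.pair c m} : Set ℕ)).preimage
      (f := fun z : ℕ → ℕ => z m') (continuous_apply m')
  have hdense : ∀ m c, Dense (G m c) := by
    intro m c
    refine dense_iff_inter_open.2 fun U hU ⟨z, hz⟩ => ?_
    obtain ⟨k, hk, hkU⟩ := exists_cylinder_subset hU hz (m + 2)
    exact ⟨Function.update z k (Nat.pair c m), hkU (update_mem_cylinder z k _),
      mem_iUnion₂.2 ⟨k, by simp only [mem_Ioi]; lia, by simp⟩⟩
  have hmem : (⋂ m, ⋂ c, G m c) ∈ residual (ℕ → ℕ) :=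
    countable_iInter_mem.2 fun m => countable_iInter_mem.2 fun c =>
      residual_of_dense_open (hopen m c) (hdense m c)
  rw [IsMeagre]
  refine mem_of_superset hmem fun z hz => ?_
  simp only [mem_compl_iff, mem_ofPred_eq, not_not]
  intro m c hlt
  obtain ⟨m', hm', hz'⟩ := mem_iUnion₂.1 (mem_iInter₂.1 hz m c)
  simp only [mem_Ioi, mem_ofPred_eq] at hm' hz'
  have htag : tag e r z m' = e c := by rw [tag_of_two_le (by lia), hz', Nat.unpair_pair]
  refine ⟨m', by lia, ?_, htag⟩
  rw [parent, hz', Nat.unpair_pair, htag, if_pos ⟨by lia, by lia, hlt⟩]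

/-- If `n` had the smaller tag `o`, fullness would give `m` a child tagged exactly `o`; the matching
child of `n` has a tag below `o`, against induction. -/
theorem IsFull.tag_le_of_rankLE {θ : Ordinal.{0}} (he : range e = Iio θ) (hr1 : r.1 ≤ θ)
    (hr2 : r.2 ≤ θ) (hz : IsFull e r z) (h : RankLE (parent e r z) m n) :
    tag e r z m ≤ tag e r z n := by
  generalize ho : tag e r z n = o
  induction o using WellFoundedLT.induction generalizing m n with
  | ind o ih =>
    by_contra! hlt
    have hθ : tag e r z m ≤ θ := by
      rw [tag]
      split_ifs
      · exact hr1
      · exact hr2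
      · exact (he.subset ⟨_, rfl⟩ : _ < θ).le
    obtain ⟨c, rfl⟩ := he.superset (hlt.trans_le hθ : o ∈ Iio θ)
    obtain ⟨m', hm', hpm, htm⟩ := hz m c hlt
    obtain ⟨n', hpn, hn', hle⟩ := h.exists_child hpm hm'
    have hn := tag_lt_of_parent_lt (hpn.trans_lt hn')
    rw [hpn, ho] at hn
    have := ih _ hn hle rfl
    rw [htm] at this
    exact this.not_gt hn

/-! ### The inseparable pair -/

theorem not_covers_and_disjoint {κ : Type u} (A : κ → Set (ℕ → ℕ)) {α : Ordinal.{0}}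
    (hα : α < Ordinal.omega 1) (hA : ∀ a, ∃ β ≤ α, IsSigma0 β (A a) ∨ IsPi0 β (A a))
    (hκ : #κ < Cardinal.lift.{u, 0} covMeager) :
    (¬ ({x | ¬ RankLE x 1 0} ⊆ ⋃ a, A a ∧ Disjoint (⋃ a, A a) {x | ¬ RankLE x 0 1})) ∧
    ¬ ({x | ¬ RankLE x 0 1} ⊆ ⋃ a, A a ∧ Disjoint (⋃ a, A a) {x | ¬ RankLE x 1 0}) := by
  -- Both root tags are at least `δ`, hence interchangeable at level `α + 2`. Other tags range over
  -- `Iio (δ + 1)`, so a root tagged `δ + 1` can have a child tagged `δ`.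
  set δ := Ordinal.omega0 * (α + 1 + 1) with hδ
  have hcard : (Iio (δ + 1)).Countable := by
    rw [← Cardinal.le_aleph0_iff_set_countable, Cardinal.mk_Iio_ordinal, Cardinal.lift_le_aleph0,
      Ordinal.card_add, hδ, Ordinal.card_mul, Ordinal.card_add, Ordinal.card_add, Ordinal.card_one,
      Ordinal.card_omega0]
    have : α.card ≤ ℵ₀ := by
      rw [Cardinal.lt_omega_iff_card_lt] at hα
      exact Cardinal.lt_aleph_one_iff.1 hα
    have h0 : (1 : Cardinal.{0}) ≤ ℵ₀ := Cardinal.one_le_aleph0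
    have h2 : α.card + 1 + 1 ≤ ℵ₀ :=
      Cardinal.add_le_aleph0.2 ⟨Cardinal.add_le_aleph0.2 ⟨this, h0⟩, h0⟩
    exact Cardinal.add_le_aleph0.2 ⟨(mul_le_mul_right h2 _).trans_eq Cardinal.aleph0_mul_aleph0, h0⟩
  obtain ⟨e, he⟩ := hcard.exists_eq_range ⟨0, by simp⟩
  have hsys := retaggingSystem_tagEquiv he.symm
  have hequiv : ∀ r s : Ordinal.{0} × Ordinal.{0}, δ ≤ r.1 → δ ≤ r.2 → δ ≤ s.1 → δ ≤ s.2 →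
      TagEquiv e (α + 1 + 1) 0 r 0 s 0 := by
    intro r s h1 h2 h3 h4 m hm
    have hm : m < 2 := by lia
    refine ⟨by rw [parent_of_lt_two hm, parent_of_lt_two hm], Or.inr ?_⟩
    interval_cases m
    exacts [⟨h1, h3⟩, ⟨h2, h4⟩]
  have hle : δ ≤ δ + 1 := (lt_add_one δ).le
  have h10 : ∀ x, IsFull e (δ, δ + 1) x → ¬ RankLE (parent e (δ, δ + 1) x) 1 0 :=
    fun x hx h => (lt_add_one δ).not_ge (by
      simpa [tag] using hx.tag_le_of_rankLE he.symm hle le_rfl h)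
  have h01 : ∀ x, IsFull e (δ + 1, δ) x → ¬ RankLE (parent e (δ + 1, δ) x) 0 1 :=
    fun x hx h => (lt_add_one δ).not_ge (by
      simpa [tag] using hx.tag_le_of_rankLE he.symm le_rfl hle h)
  have key : ∀ (r s : Ordinal.{0} × Ordinal.{0}) (P Q : Set (ℕ → ℕ)),
      TagEquiv e (α + 1 + 1) 0 r 0 s 0 → (∀ x, IsFull e r x → parent e r x ∈ P) →
      (∀ x, IsFull e s x → parent e s x ∈ Q) → ¬ (P ⊆ ⋃ a, A a ∧ Disjoint (⋃ a, A a) Q) := by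
    rintro r s P Q hrs hP hQ ⟨hPA, hAQ⟩
    obtain ⟨a, ha⟩ := hsys.exists_not_isMeagre A hA hκ hrs (isMeagre_not_isFull (e := e) (r := r))
      fun x hx => hPA (hP x (not_not.1 hx))
    refine ha ((isMeagre_not_isFull (e := e) (r := s)).mono ?_)
    intro x hx hfull
    exact disjoint_left.1 hAQ (mem_iUnion.2 ⟨a, hx⟩) (hQ x hfull)
  exact ⟨key _ _ _ _ (hequiv _ _ le_rfl hle hle le_rfl) h10 h01,
    key _ _ _ _ (hequiv _ _ hle le_rfl le_rfl hle) h01 h10⟩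

theorem exists_continuous_injective_baire (X : Type u) [TopologicalSpace X] [PolishSpace X]
    [Uncountable X] : ∃ f : (ℕ → ℕ) → X, Continuous f ∧ Function.Injective f := by
  obtain ⟨g, -, hg, hinj⟩ := (isClosed_univ (X := X)).exists_nat_bool_injection_of_not_countable
    (by rw [countable_univ_iff]; exact not_countable)
  -- Each `z` is sent to the characteristic function of its graph.
  refine ⟨fun z => g fun i => decide (z i.unpair.1 = i.unpair.2), hg.comp ?_, ?_⟩
  · exact continuous_pi fun i => (continuous_of_discreteTopology
      (f := fun k : ℕ => decide (k = i.unpair.2))).comp (continuous_apply i.unpair.1)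
  · intro z w h
    funext m
    have := congrFun (hinj h) (Nat.pair m (z m))
    simpa [eq_comm] using this

/-- The complement is the image of `Sᶜ` together with the complement of the range, which is Borel by
Lusin–Souslin. -/
theorem isCoanalytic_image {X : Type u} [TopologicalSpace X] [PolishSpace X] {f : (ℕ → ℕ) → X}
    (hf : Continuous f) (hinj : Function.Injective f) {S : Set (ℕ → ℕ)} (hS : AnalyticSet Sᶜ) :
    IsCoanalytic (f '' S) := by
  borelize X
  have h1 : AnalyticSet (range f)ᶜ :=
    (measurableSet_range_of_continuous_injective hf hinj).compl.analyticSet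
  have h2 : AnalyticSet (⋃ b : Bool, cond b (range f)ᶜ (f '' Sᶜ)) :=
    .iUnion fun b => by cases b; exacts [hS.image_of_continuous hf, h1]
  rw [← union_eq_iUnion] at h2
  rw [IsCoanalytic, hinj.compl_image_eq, union_comm]
  exact h2

end BorelSep

open BorelSep in
theorem corollary4 (X : Type u) [TopologicalSpace X] [PolishSpace X] [Uncountable X] :
    ∃ C D : Set X, BorelSep.IsCoanalytic C ∧ BorelSep.IsCoanalytic D ∧ Disjoint C D ∧
      ∀ F : Set (Set X), BorelSep.HasBoundedBorelRank F →
        Cardinal.mk F < Cardinal.lift.{u, 0} BorelSep.covMeager →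
          ¬ BorelSep.Separates (⋃₀ F) C D ∧ ¬ BorelSep.Separates (⋃₀ F) D C := by
  obtain ⟨f, hf, hinj⟩ := exists_continuous_injective_baire X
  refine ⟨f '' {x | ¬ RankLE x 1 0}, f '' {x | ¬ RankLE x 0 1},
    isCoanalytic_image hf hinj (by simpa [Set.compl_ofPred] using analyticSet_rankLE 1 0),
    isCoanalytic_image hf hinj (by simpa [Set.compl_ofPred] using analyticSet_rankLE 0 1), ?_, ?_⟩
  · rw [Set.disjoint_image_iff hinj, Set.disjoint_left]
    intro x h1 h2
    exact (rankLE_total x 1 0).elim h1 h2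
  · rintro F ⟨α, hα, hF⟩ hcard
    have hpre : f ⁻¹' ⋃₀ F = ⋃ s : F, f ⁻¹' s := by
      rw [Set.sUnion_eq_iUnion, Set.preimage_iUnion]
    have hsep : ∀ P Q : Set (ℕ → ℕ), Separates (⋃₀ F) (f '' P) (f '' Q) →
        P ⊆ ⋃ s : F, f ⁻¹' s ∧ Disjoint (⋃ s : F, f ⁻¹' s) Q := by
      rintro P Q ⟨h1, h2⟩
      rw [← hpre]
      refine ⟨Set.image_subset_iff.1 h1, Set.disjoint_left.2 fun x hx hQ => ?_⟩
      exact Set.disjoint_left.1 h2 hx (Set.mem_image_of_mem f hQ)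
    have hnot := not_covers_and_disjoint (fun s : F => f ⁻¹' (s : Set X)) hα
      (fun s => by
        obtain ⟨β, hβ, h | h⟩ := hF s s.2
        · exact ⟨β, hβ, Or.inl (h.preimage hf)⟩
        · exact ⟨β, hβ, Or.inr (IsSigma0.preimage hf h)⟩) hcard
    exact ⟨fun h => hnot.1 (hsep _ _ h), fun h => hnot.2 (hsep _ _ h)⟩
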